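/- All semigroups, monoids, groups and categories are finite. A pseudovariety of monoids (respectively groups) is a class of finite monoids (groups) closed under homomorphic images, submonoids (subgroups) and finite direct products. A pseudovariety $\mathbf H$ of groups is Fitting if, whenever $G$ is a finite group and $A,B\lhd G$ are normal subgroups belonging to $\mathbf H$, then $AB\in\mathbf H$. Let $\mathbf{LH}$ denote the class of all finite semigroups $S$ such that, for every idempotent $e\in S$, the local monoid $eSe$ is a group belonging to $\mathbf H$. For a pseudovariety $\mathbf V$ of monoids, the Mal'cev product $\mathbf{LH}\mathbin{\circ_{m}}\mathbf V$ is the pseudovariety of monoids generated by all finite monoids $M$ having a homomorphism $\varphi:M\to N$ with $N\in\mathbf V$ such that $e\varphi^{-1}\in\mathbf{LH}$ for every idempotent $e\in N$. For a pseudovariety $\mathbf W$ of monoids, $\ell\mathbf W$ is the class of all finite categories $C$ such that, for every object $c$ of $C$, the local monoid $C_c=C(c,c)$ belongs to $\mathbf W$. A quotient morphism of categories is a functor that is bijective on objects and surjective on each hom set. An $\mathbf{LH}$-morphism is a quotient morphism $\varphi:C\to D$ such that $e\varphi^{-1}\in\mathbf{LH}$ for every idempotent arrow $e$ of $D$. Theorem.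 Let $\mathbf V$ be a pseudovariety of monoids, let $\mathbf H$ be a Fitting pseudovariety of groups, and let $C$ be a finite category. Then $C\in\ell(\mathbf{LH}\mathbin{\circ_{m}}\mathbf V)$ if and only if there is an $\mathbf{LH}$-morphism $\varphi:C\to D$ to some category $D\in\ell\mathbf V$. -/

import Mathlib

open CategoryTheory

universe w u

/-- A pseudovariety of monoids: a class of finite monoids closed under homomorphic images,
submonoids and finite direct products (including the empty product). -/
structure MonoidPseudovariety where
  /-- membership in the pseudovariety -/
  mem : (M : Type u) → [Monoid M] → Prop
  finite_of_mem : ∀ (M : Type u) [Monoid M], mem M → Finite M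
  mem_punit : mem PUnit.{u + 1}
  mem_prod : ∀ (M N : Type u) [Monoid M] [Monoid N], mem M → mem N → mem (M × N)
  mem_submonoid : ∀ (M : Type u) [Monoid M] (P : Submonoid M), mem M → mem P
  mem_of_surjective : ∀ (M N : Type u) [Monoid M] [Monoid N] (f : M →* N),
    Function.Surjective f → mem M → mem N

/-- A pseudovariety of groups: a class of finite groups closed under homomorphic images,
subgroups and finite direct products (including the empty product). -/
structure GroupPseudovariety where
  /-- membership in the pseudovariety -/
  mem : (G : Type u) → [Group G] → Prop
  finite_of_mem : ∀ (G : Type u) [Group G], mem G → Finite G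
  mem_punit : mem PUnit.{u + 1}
  mem_prod : ∀ (G K : Type u) [Group G] [Group K], mem G → mem K → mem (G × K)
  mem_subgroup : ∀ (G : Type u) [Group G] (P : Subgroup G), mem G → mem P
  mem_of_surjective : ∀ (G K : Type u) [Group G] [Group K] (f : G →* K),
    Function.Surjective f → mem G → mem K

/-- A pseudovariety of groups is Fitting if in every finite group the product of two normal
subgroups belonging to it belongs to it. (For normal subgroups, the product is the join.) -/
def GroupPseudovariety.IsFitting (H : GroupPseudovariety.{u}) : Prop :=
  ∀ (G : Type u) [Group G] [Finite G] (A B : Subgroup G), A.Normal → B.Normal →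
    H.mem A → H.mem B → H.mem (A ⊔ B : Subgroup G)

/-- The pseudovariety of all finite monoids. -/
def MonoidPseudovariety.all : MonoidPseudovariety.{u} where
  mem M _ := Finite M
  finite_of_mem _ _ h := h
  mem_punit := inferInstance
  mem_prod _ _ _ _ _ _ := inferInstance
  mem_submonoid _ _ _ _ := inferInstance
  mem_of_surjective _ _ _ _ f hf _ := Finite.of_surjective f hf

/-- The pseudovariety of monoids generated by the finite monoids in the class `K`, i.e. the
smallest pseudovariety of monoids that contains all of them. -/
def MonoidPseudovariety.generated (K : (M : Type u) → [Monoid M] → Prop) :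
    MonoidPseudovariety.{u} where
  mem M _ := ∀ W : MonoidPseudovariety.{u},
    (∀ (N : Type u) [Monoid N] [Finite N], K N → W.mem N) → W.mem M
  finite_of_mem _ _ h := h MonoidPseudovariety.all (fun _ _ hN _ => hN)
  mem_punit W _ := W.mem_punit
  mem_prod M N _ _ hM hN W hW := W.mem_prod M N (hM W hW) (hN W hW)
  mem_submonoid M _ P hM W hW := W.mem_submonoid M P (hM W hW)
  mem_of_surjective M N _ _ f hf hM W hW := W.mem_of_surjective M N f hf (hM W hW)

/-- `S` belongs to `LH`: `S` is a finite semigroup each of whose local monoids `eSe`, with `e`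
idempotent, is a group belonging to `H`. -/
def GroupPseudovariety.MemL (H : GroupPseudovariety.{u}) (S : Type u) [Semigroup S] : Prop :=
  Finite S ∧ ∀ e : S, IsIdempotentElem e →
    ∃ (G : Type u) (_ : Group G), H.mem G ∧ Nonempty (Subsemigroup.corner e ≃* G)

/-- The preimage of an idempotent under a monoid homomorphism, as a subsemigroup. -/
def idempotentPreimage {M N : Type u} [Monoid M] [Monoid N] (f : M →* N) (e : N)
    (he : IsIdempotentElem e) : Subsemigroup M where
  carrier := {m | f m = e}
  mul_mem' {a b} ha hb := by
    change f (a * b) = e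
    rw [map_mul, show f a = e from ha, show f b = e from hb, he]

/-- The Mal'cev product of a class `U` of semigroups and a pseudovariety `V` of monoids: the
pseudovariety of monoids generated by the finite monoids `M` that have a homomorphism to some
`N` in `V` under which the preimage of every idempotent of `N` belongs to `U`. -/
def malcevProduct (U : (S : Type u) → [Semigroup S] → Prop) (V : MonoidPseudovariety.{u}) :
    MonoidPseudovariety.{u} :=
  MonoidPseudovariety.generated fun M _ =>
    ∃ (N : Type u) (_ : Monoid N) (f : M →* N), V.mem N ∧
      ∀ (e : N) (he : IsIdempotentElem e), U (idempotentPreimage f e he)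

/-- The local monoid `C(c, c)` of a category `C` at an object `c`. Arrows are multiplied in
diagrammatic order: `f * g` is `f` followed by `g` (Mathlib's `End c` is the opposite monoid). -/
def LocalMonoid {C : Type w} [Category.{u} C] (c : C) : Type u := c ⟶ c

instance {C : Type w} [Category.{u} C] (c : C) : Monoid (LocalMonoid c) where
  mul f g := CategoryStruct.comp (X := c) (Y := c) (Z := c) f g
  one := 𝟙 c
  mul_assoc _ _ _ := Category.assoc _ _ _
  one_mul _ := Category.id_comp _
  mul_one _ := Category.comp_id _

/-- The monoid homomorphism `C(c, c) → D(φ c, φ c)` induced by a functor `φ`. -/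
def localHom {C D : Type w} [Category.{u} C] [Category.{u} D] (φ : C ⥤ D) (c : C) :
    LocalMonoid c →* LocalMonoid (φ.obj c) where
  toFun f := φ.map (X := c) (Y := c) f
  map_one' := φ.map_id c
  map_mul' f g := φ.map_comp (X := c) (Y := c) (Z := c) f g

/-- Finite categories: finitely many objects and finitely many arrows. -/
def IsFiniteCategory (C : Type w) [Category.{u} C] : Prop :=
  Finite C ∧ ∀ c c' : C, Finite (c ⟶ c')

/-- `C` belongs to `ℓV`: it is a finite category all of whose local monoids belong to `V`. -/
def MonoidPseudovariety.MemLocal (V : MonoidPseudovariety.{u}) (C : Type w) [Category.{u} C] :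
    Prop :=
  IsFiniteCategory C ∧ ∀ c : C, V.mem (LocalMonoid c)

/-- Quotient morphisms of categories: bijective on objects and surjective on each hom set. -/
def IsQuotientMorphism {C D : Type w} [Category.{u} C] [Category.{u} D] (φ : C ⥤ D) : Prop :=
  Function.Bijective φ.obj ∧
    ∀ c c' : C, Function.Surjective (φ.map : (c ⟶ c') → (φ.obj c ⟶ φ.obj c'))

/-- `LH`-morphisms: quotient morphisms under which the preimage of every idempotent arrow belongs
to `LH`. As `φ` is bijective on objects, every idempotent arrow of `D` is an endomorphism of
`φ.obj c` for a unique object `c` of `C`, and all arrows mapped to it are endomorphisms of `c`. -/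
def IsLHMorphism (H : GroupPseudovariety.{u}) {C D : Type w} [Category.{u} C] [Category.{u} D]
    (φ : C ⥤ D) : Prop :=
  IsQuotientMorphism φ ∧
    ∀ (c : C) (e : LocalMonoid (φ.obj c)) (he : IsIdempotentElem e),
      H.MemL (idempotentPreimage (localHom φ c) e he)

/-! Every finite monoid has a largest congruence whose quotient map pulls idempotents back into
`LH`, namely `radicalCon`. As `H` is Fitting, the `H`-radical of a finite group lies in `H`, so the
quotient by `radicalCon` has this property (`isLHHom_of_ker_le`); conversely the kernel of any such
homomorphism lies in `radicalCon` (`IsLHHom.ker_le`). It follows that the monoids `M` with `M /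
radicalCon` in `V` form a pseudovariety containing the generators of the Mal'cev product, hence all
its members.

In a finite category, a translate that is a unit at an idempotent of one local monoid can be
transported to a conjugate idempotent of another. So the radical congruences at the various objects
are compatible (`radicalCon_translate`) and are the restrictions of a single congruence on `C`,
whose quotient is `D`. For the converse, the local homomorphisms of `φ` exhibit each local monoid as
a generator. -/

theorem GroupPseudovariety.mem_of_injective (H : GroupPseudovariety.{u}) {G K : Type u} [Group G]
    [Group K] (f : G →* K) (hf : Function.Injective f) (hK : H.mem K) : H.mem G :=
  H.mem_of_surjective _ _ (MonoidHom.ofInjective hf).symm.toMonoidHom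
    (MonoidHom.ofInjective hf).symm.surjective (H.mem_subgroup K f.range hK)

/-! ### The `H`-radical of a group and the relation it induces on a monoid. -/

/-- The `H`-radical of a group: the join of all normal subgroups belonging to `H`. -/
def GroupPseudovariety.radical (H : GroupPseudovariety.{u}) (G : Type u) [Group G] :
    Subgroup G :=
  sSup {N | N.Normal ∧ H.mem N}

theorem GroupPseudovariety.le_radical (H : GroupPseudovariety.{u}) {G : Type u} [Group G]
    {N : Subgroup G} (hN : N.Normal) (h : H.mem N) : N ≤ H.radical G :=
  le_sSup ⟨hN, h⟩

theorem GroupPseudovariety.radical_normal (H : GroupPseudovariety.{u}) (G : Type u) [Group G] :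
    (H.radical G).Normal :=
  Subgroup.sSup_normal _ fun _ h => h.1

/-- By the Fitting property, joining a maximal normal `H`-subgroup with any other stays in the
family, so the maximal one is the greatest. -/
theorem GroupPseudovariety.IsFitting.mem_radical {H : GroupPseudovariety.{u}} (hH : H.IsFitting)
    (G : Type u) [Group G] [Finite G] : H.mem (H.radical G) := by
  have hbot : (⊥ : Subgroup G) ∈ {N : Subgroup G | N.Normal ∧ H.mem N} :=
    ⟨inferInstance, H.mem_of_surjective PUnit _ 1
      (fun x => ⟨PUnit.unit, Subsingleton.elim _ _⟩) H.mem_punit⟩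
  obtain ⟨N, hN, hmax⟩ := (Set.toFinite {N : Subgroup G | N.Normal ∧ H.mem N}).exists_maximal
    ⟨⊥, hbot⟩
  have : H.radical G = N := by
    refine le_antisymm (sSup_le fun K hK => ?_) (le_sSup hN)
    have := hN.1
    have := hK.1
    exact le_sup_right.trans
      (hmax ⟨inferInstance, hH G N K hN.1 hK.1 hN.2 hK.2⟩ (le_sup_left : N ≤ N ⊔ K))
  rw [this]
  exact hN.2

theorem GroupPseudovariety.map_radical_le {H : GroupPseudovariety.{u}} (hH : H.IsFitting)
    {G K : Type u} [Group G] [Finite G] [Group K] (f : G →* K) (hf : Function.Surjective f) :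
    (H.radical G).map f ≤ H.radical K :=
  H.le_radical ((H.radical_normal G).map f hf)
    (H.mem_of_surjective _ _ (f.subgroupMap (H.radical G)) (f.subgroupMap_surjective _)
      (hH.mem_radical G))

/-- The relation identifying all non-units, and all units in the same coset of the `H`-radical. -/
def GroupPseudovariety.UnitRel (H : GroupPseudovariety.{u}) {A : Type u} [Monoid A] (a b : A) :
    Prop :=
  (IsUnit a ↔ IsUnit b) ∧ ∀ u v : Aˣ, (u : A) = a → (v : A) = b → u⁻¹ * v ∈ H.radical Aˣ

namespace GroupPseudovariety.UnitRel

variable {H : GroupPseudovariety.{u}} {A B : Type u} [Monoid A] [Monoid B]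

theorem refl (a : A) : H.UnitRel a a := by
  refine ⟨Iff.rfl, fun u v hu hv => ?_⟩
  rw [show u = v from Units.ext (hu.trans hv.symm), inv_mul_cancel]
  exact one_mem _

theorem symm {a b : A} (h : H.UnitRel a b) : H.UnitRel b a := by
  refine ⟨h.1.symm, fun u v hu hv => ?_⟩
  have := inv_mem (h.2 v u hv hu)
  rwa [mul_inv_rev, inv_inv] at this

theorem trans {a b c : A} (h : H.UnitRel a b) (h' : H.UnitRel b c) : H.UnitRel a c := by
  refine ⟨h.1.trans h'.1, fun u v hu hv => ?_⟩
  obtain ⟨w, hw⟩ := h.1.1 ⟨u, hu⟩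
  have := mul_mem (h.2 u w hu hw) (h'.2 w v hw hv)
  rwa [mul_assoc, mul_inv_cancel_left] at this

/-- Since `q` reflects units, it is surjective on unit groups, so it carries radical into radical.
-/
theorem map (hH : H.IsFitting) [Finite A] (q : A →* B) (hq : Function.Surjective q)
    (hu : ∀ a, IsUnit (q a) → IsUnit a) {a b : A} (h : H.UnitRel a b) :
    H.UnitRel (q a) (q b) := by
  refine ⟨⟨fun ha => (h.1.1 (hu a ha)).map q, fun hb => (h.1.2 (hu b hb)).map q⟩, ?_⟩
  intro u' v' hu' hv'
  obtain ⟨u, rfl⟩ := hu a (hu' ▸ u'.isUnit)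
  obtain ⟨v, rfl⟩ := hu b (hv' ▸ v'.isUnit)
  obtain rfl : u' = Units.map q u := Units.ext hu'
  obtain rfl : v' = Units.map q v := Units.ext hv'
  have hs : Function.Surjective (Units.map q) := by
    intro x
    obtain ⟨a, ha⟩ := hq x
    obtain ⟨y, rfl⟩ := hu a (ha ▸ x.isUnit)
    exact ⟨y, Units.ext ha⟩
  have := GroupPseudovariety.map_radical_le hH (Units.map q) hs
    (Subgroup.mem_map_of_mem _ (h.2 u v rfl rfl))
  rwa [map_mul, map_inv] at this

end GroupPseudovariety.UnitRel

/-! ### Local monoids at idempotents. -/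

instance IsIdempotentElem.Corner.instMonoid {M : Type u} [Semigroup M] {e : M}
    (he : IsIdempotentElem e) : Monoid he.Corner where
  __ : Semigroup he.Corner := inferInstanceAs (Semigroup (Subsemigroup.corner e))
  one := ⟨e, e, by simp_rw [he.eq]⟩
  one_mul r := Subtype.ext ((Subsemigroup.mem_corner_iff he).mp r.2).1
  mul_one r := Subtype.ext ((Subsemigroup.mem_corner_iff he).mp r.2).2

namespace IsIdempotentElem.Corner

instance {M : Type u} [Semigroup M] [Finite M] {e : M} (he : IsIdempotentElem e) :
    Finite he.Corner :=
  inferInstanceAs (Finite (Subsemigroup.corner e))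

section Semigroup

variable {M : Type u} [Semigroup M] {e : M} (he : IsIdempotentElem e)

@[simp] theorem val_one : (1 : he.Corner).1 = e := rfl

@[simp] theorem left_mul (a : he.Corner) : e * a.1 = a.1 :=
  ((Subsemigroup.mem_corner_iff he).mp a.2).1

@[simp] theorem mul_right (a : he.Corner) : a.1 * e = a.1 :=
  ((Subsemigroup.mem_corner_iff he).mp a.2).2

/-- The element `e * x * e` of the local monoid at `e`. -/
def compress (x : M) : he.Corner := ⟨e * x * e, x, rfl⟩

@[simp] theorem val_compress (x : M) : (compress he x).1 = e * x * e := rfl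

theorem compress_val (a : he.Corner) : compress he a.1 = a :=
  Subtype.ext (by simp)

end Semigroup

variable {M N : Type u} [Monoid M] [Monoid N] {e : M} (he : IsIdempotentElem e)

/-- The homomorphism of local monoids induced by a homomorphism. -/
def map (f : M →* N) {e' : N} (he' : IsIdempotentElem e') (h : f e = e') :
    he.Corner →* he'.Corner where
  toFun a := ⟨f a.1, f a.1, by
    subst h
    simp only [← map_mul, left_mul, mul_right]⟩
  map_one' := Subtype.ext h
  map_mul' a b := Subtype.ext (map_mul f a.1 b.1)

@[simp] theorem val_map (f : M →* N) {e' : N} (he' : IsIdempotentElem e') (h : f e = e')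
    (a : he.Corner) : (map he f he' h a).1 = f a.1 := rfl

theorem map_compress (f : M →* N) {e' : N} (he' : IsIdempotentElem e') (h : f e = e')
    (x : M) : map he f he' h (compress he x) = compress he' (f x) :=
  Subtype.ext (by subst h; simp)

end IsIdempotentElem.Corner

open IsIdempotentElem.Corner

/-! ### The radical congruence as the largest `LH`-congruence. -/

/-- Two elements are congruent if, in every local monoid, every translate of one of them is a unit
exactly when the same translate of the other one is, and then the two units agree modulo the
`H`-radical. -/
def GroupPseudovariety.radicalCon (H : GroupPseudovariety.{u}) (M : Type u) [Monoid M] :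
    Con M where
  r s t := ∀ (e : M) (he : IsIdempotentElem e) (x y : M),
    H.UnitRel (compress he (x * s * y)) (compress he (x * t * y))
  iseqv :=
    { refl := fun _ _ _ _ _ => .refl _
      symm := fun h e he x y => (h e he x y).symm
      trans := fun h h' e he x y => (h e he x y).trans (h' e he x y) }
  mul' {s s' t t'} h h' e he x y := by
    -- The factors are replaced one at a time, the other being absorbed into the translating
    -- element.
    have h₁ := h e he x (t * y)
    have h₂ := h' e he (x * s') y
    simp only [mul_assoc] at h₁ h₂ ⊢
    exact h₁.trans h₂

/-- Homomorphisms under which the preimage of every idempotent belongs to `LH`. -/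
def IsLHHom (H : GroupPseudovariety.{u}) {M N : Type u} [Monoid M] [Monoid N] (f : M →* N) :
    Prop :=
  ∀ (e : N) (he : IsIdempotentElem e), H.MemL (idempotentPreimage f e he)

/-- A homomorphism whose kernel is contained in the radical congruence is an `LH`-morphism. -/
theorem isLHHom_of_ker_le {H : GroupPseudovariety.{u}} (hH : H.IsFitting) {M N : Type u} [Monoid M]
    [Finite M] [Monoid N] (f : M →* N) (hf : ∀ s t, f s = f t → H.radicalCon M s t) :
    IsLHHom H f := by
  intro e he
  refine ⟨inferInstance, fun ε hε => ?_⟩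
  have hε' : IsIdempotentElem (ε : M) := congrArg Subtype.val hε
  have hfε : f ε = e := ε.2
  -- The local semigroup at `ε` turns out to be exactly this group of units.
  let P : Subgroup hε'.Cornerˣ :=
    H.radical _ ⊓ (Units.map (map hε' f he hfε)).ker
  have hP (u : hε'.Cornerˣ) (hu : u ∈ P) : f u.val.1 = e := by
    have := congrArg (fun v => v.val.1) (show _ = _ from hu.2)
    simpa using this
  refine ⟨P, inferInstance, ?_, ⟨MulEquiv.symm (MulEquiv.ofBijective
    ({ toFun := fun u => ⟨⟨u.1.val.1, hP u.1 u.2⟩, ⟨u.1.val.1, hP u.1 u.2⟩,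
          Subtype.ext (by simp)⟩
       map_mul' := fun u v => rfl } : P →ₙ* Subsemigroup.corner ε) ⟨?_, ?_⟩)⟩⟩
  · exact H.mem_of_injective (Subgroup.inclusion inf_le_left) (Subgroup.inclusion_injective _)
      (hH.mem_radical _)
  · intro u v h
    exact Subtype.ext (Units.ext (Subtype.ext (congrArg (fun a => a.1.1) h)))
  · rintro ⟨s, hs⟩
    obtain ⟨hl, hr⟩ := (Subsemigroup.mem_corner_iff hε).1 hs
    have hl' : (ε : M) * s = s := congrArg Subtype.val hl
    have hr' : (s : M) * ε = s := congrArg Subtype.val hr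
    have hfs : f s = e := s.2
    -- `s` and `ε` have the same image, so `s` is congruent to the identity of the local monoid at
    -- `ε`.
    have h := hf ε s (hfε.trans hfs.symm) ε hε' 1 1
    rw [show compress hε' (1 * ε * 1) = 1 from Subtype.ext (by simp [hε'.eq])] at h
    obtain ⟨u, hu⟩ := h.1.1 isUnit_one
    have hus : u.val.1 = s := by simpa [hl', hr', mul_assoc] using congrArg Subtype.val hu
    refine ⟨⟨u, ?_, ?_⟩, Subtype.ext (Subtype.ext hus)⟩
    · simpa using h.2 1 u rfl hu
    · exact Units.ext (Subtype.ext (by simp [hus, hfs]))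

/-- The kernel of an `LH`-morphism is contained in the radical congruence. -/
theorem IsLHHom.ker_le {H : GroupPseudovariety.{u}} {M N : Type u} [Monoid M]
    [Monoid N] {f : M →* N} (hf : IsLHHom H f) {s t : M} (hst : f s = f t) :
    H.radicalCon M s t := by
  intro e he x y
  have hfe : IsIdempotentElem (f e) := he.map f
  let F := map he f hfe rfl
  obtain ⟨-, hS⟩ := hf (f e) hfe
  have hε : IsIdempotentElem (⟨e, rfl⟩ : idempotentPreimage f (f e) hfe) := Subtype.ext he
  obtain ⟨G, _, hG, ⟨ι⟩⟩ := hS _ hε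
  -- The fibre of `F` over `1` is the local semigroup at `e` of an idempotent preimage, hence a
  -- group in `H`.
  let j (a : he.Corner) (ha : F a = 1) :
      Subsemigroup.corner (⟨e, rfl⟩ : idempotentPreimage f (f e) hfe) :=
    ⟨⟨a.1, congrArg Subtype.val ha⟩, ⟨a.1, congrArg Subtype.val ha⟩, Subtype.ext (by simp)⟩
  have hj (a ha b hb hab) : j a ha * j b hb = j (a * b) hab := rfl
  have hj1 : ι (j 1 (map_one F)) = 1 := by
    rw [← mul_eq_left (a := ι (j 1 (map_one F))), ← map_mul,
      hj 1 (map_one F) 1 (map_one F) (by rw [mul_one, map_one])]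
    simp only [mul_one]
  have hF1 {a b : he.Corner} (ha : F a = 1) (hb : F b = 1) : F (a * b) = 1 := by
    rw [map_mul, ha, hb, mul_one]
  have hunit (a : he.Corner) (ha : F a = 1) : IsUnit a := by
    have key (g : G) : ∃ b : he.Corner, ∃ hb : F b = 1, ι (j b hb) = g := by
      obtain ⟨⟨⟨b, hb⟩, hb'⟩, rfl⟩ := ι.surjective g
      obtain ⟨hl, hr⟩ := (Subsemigroup.mem_corner_iff hε).1 hb'
      exact ⟨⟨b, (Subsemigroup.mem_corner_iff he).2
        ⟨congrArg Subtype.val hl, congrArg Subtype.val hr⟩⟩, Subtype.ext hb, rfl⟩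
    obtain ⟨b, hb, h⟩ := key (ι (j a ha))⁻¹
    have inj (c hc) (h : ι (j c hc) = 1) : c = 1 := by
      have := congrArg (fun a => a.1.1) (ι.injective (h.trans hj1.symm))
      exact Subtype.ext this
    refine ⟨⟨a, b, inj _ (hF1 ha hb) ?_, inj _ (hF1 hb ha) ?_⟩, rfl⟩
    · rw [← hj a ha b hb (hF1 ha hb), map_mul, h, mul_inv_cancel]
    · rw [← hj b hb a ha (hF1 hb ha), map_mul, h, inv_mul_cancel]
  have hker : H.mem (Units.map F).ker := by
    have hmem (u : (Units.map F).ker) : F u.1.val = 1 := congrArg Units.val (show _ = _ from u.2)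
    refine H.mem_of_injective (MonoidHom.mk' (fun u => ι (j u.1.val (hmem u))) ?_) ?_ hG
    · intro u v
      rw [← map_mul]
      rfl
    · intro u v h
      have := congrArg (fun a => a.1.1) (ι.injective h)
      exact Subtype.ext (Units.ext (Subtype.ext this))
  have hF : F (compress he (x * s * y)) = F (compress he (x * t * y)) :=
    Subtype.ext (by simp [F, hst])
  -- Here `a⁻¹ * b` lies over `1`, so it is a unit.
  have half {a b : he.Corner} (hab : F a = F b) (ha : IsUnit a) : IsUnit b := by
    obtain ⟨u, rfl⟩ := ha
    have : IsUnit ((u⁻¹ : he.Cornerˣ) * b) :=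
      hunit _ (by rw [map_mul, ← hab, ← map_mul, Units.inv_mul, map_one])
    simpa using this
  refine ⟨⟨half hF, half hF.symm⟩, fun u v hu hv => H.le_radical inferInstance hker ?_⟩
  rw [MonoidHom.mem_ker, map_mul, map_inv, inv_mul_eq_one]
  exact Units.ext (by simp [hu, hv, hF])

/-! ### Homomorphic images: lifting idempotents. -/

theorem exists_isIdempotentElem_pow {M : Type u} [Monoid M] [Finite M] (x : M) :
    ∃ n, n ≠ 0 ∧ IsIdempotentElem (x ^ n) := by
  obtain ⟨m, n, hmn, h⟩ := Finite.exists_ne_map_eq_of_infinite (fun n : ℕ => x ^ n)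
  wlog hlt : m < n generalizing m n
  · exact this n m hmn.symm h.symm (by omega)
  obtain ⟨p, hp, rfl⟩ := Nat.exists_eq_add_of_lt hlt
  replace h : x ^ m * x ^ (p + 1) = x ^ m := by
    rw [← pow_add]; exact h.symm
  have h' (i : ℕ) : x ^ m * x ^ (i * (p + 1)) = x ^ m := by
    induction i with
    | zero => simp
    | succ i ih => rw [add_mul, one_mul, pow_add, ← mul_assoc, ih, h]
  -- A positive multiple of the period `p + 1` that is at least the preperiod `m`.
  refine ⟨(m + 1) * (p + 1), by positivity, ?_⟩
  have : (m + 1) * (p + 1) = (m * p + p + 1) + m := by ring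
  change _ * _ = _
  nth_rw 1 3 [this]
  rw [pow_add, mul_assoc, h']

/-- An idempotent minimal among those lying over `e'`. -/
theorem exists_idempotent_lift {M N : Type u} [Monoid M] [Finite M] [Monoid N] (q : M →* N)
    (hq : Function.Surjective q) {e' : N} (he' : IsIdempotentElem e') :
    ∃ (e : M) (he : IsIdempotentElem e) (h : q e = e'),
      ∀ a : he.Corner, IsUnit (map he q he' h a) → IsUnit a := by
  have hne : {e : M | IsIdempotentElem e ∧ q e = e'}.Nonempty := by
    obtain ⟨x, rfl⟩ := hq e'
    obtain ⟨n, hn, hx⟩ := exists_isIdempotentElem_pow x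
    exact ⟨x ^ n, hx, by rw [map_pow, he'.pow_eq hn]⟩
  -- Choose `e` with smallest local monoid. If `a` maps to a unit, an idempotent power of `a` lies
  -- over `e'` with local monoid inside that of `e`; minimality forces this power to be `e`.
  obtain ⟨e, ⟨he, h⟩, hmin⟩ :=
    (Set.toFinite {e : M | IsIdempotentElem e ∧ q e = e'}).exists_minimalFor
      (fun e => Nat.card (Subsemigroup.corner e)) _ hne
  refine ⟨e, he, h, fun a ha => ?_⟩
  obtain ⟨n, hn, hx⟩ := exists_isIdempotentElem_pow a
  suffices a ^ n = 1 from (isUnit_pow_iff hn).1 (this ▸ isUnit_one)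
  have hqa : map he q he' h (a ^ n) = 1 := by
    have h₁ := ha.pow n
    rw [← map_pow] at h₁
    exact (IsIdempotentElem.iff_eq_one_of_isUnit h₁).1 (hx.map _)
  have hfe : IsIdempotentElem (a ^ n).1 := congrArg Subtype.val hx
  have hle : (Subsemigroup.corner (a ^ n).1 : Set M) ⊆ Subsemigroup.corner e := by
    rintro _ ⟨x, rfl⟩
    refine (Subsemigroup.mem_corner_iff he).2 ⟨?_, ?_⟩
    · simp [← mul_assoc]
    · simp [mul_assoc]
  have hcard := hmin ⟨hfe, congrArg Subtype.val hqa⟩ (Nat.card_mono (Set.toFinite _) hle)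
  have heq := Set.eq_of_subset_of_ncard_le hle hcard
  have hmem : e ∈ (Subsemigroup.corner (a ^ n).1 : Set M) := heq ▸ (1 : he.Corner).2
  have := ((Subsemigroup.mem_corner_iff hfe).1 hmem).1
  rw [mul_right] at this
  exact Subtype.ext this

/-- At a minimal lift of an idempotent the induced map of local monoids is surjective and reflects
units, so `UnitRel.map` applies. -/
theorem GroupPseudovariety.radicalCon_map {H : GroupPseudovariety.{u}} (hH : H.IsFitting)
    {M N : Type u} [Monoid M] [Finite M] [Monoid N] (q : M →* N) (hq : Function.Surjective q)
    {s t : M} (h : H.radicalCon M s t) : H.radicalCon N (q s) (q t) := by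
  intro e' he' x' y'
  obtain ⟨x, rfl⟩ := hq x'
  obtain ⟨y, rfl⟩ := hq y'
  obtain ⟨e, he, hqe, hu⟩ := exists_idempotent_lift q hq he'
  have hs : Function.Surjective (map he q he' hqe) := by
    intro b
    obtain ⟨z, hz⟩ := hq b.1
    exact ⟨compress he z, by rw [map_compress]; simp [hz, compress_val]⟩
  have := (h e he x y).map hH _ hs hu
  simpa [map_compress] using this

/-! ### Products and submonoids. -/

/-- The homomorphism of local semigroups induced by a homomorphism of semigroups. -/
def Subsemigroup.cornerMap {S T : Type u} [Semigroup S] [Semigroup T] (g : S →ₙ* T) (ε : S) :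
    Subsemigroup.corner ε →ₙ* Subsemigroup.corner (g ε) where
  toFun x := ⟨g x.1, by
    obtain ⟨_, x, rfl⟩ := x
    exact ⟨g x, by simp only [map_mul]⟩⟩
  map_mul' x y := Subtype.ext (map_mul g x.1 y.1)

/-- A nonempty subsemigroup of a finite group is a subgroup, inverses being powers. -/
theorem GroupPseudovariety.memL_of_injective_corner (H : GroupPseudovariety.{u}) {S : Type u}
    [Semigroup S] [Finite S]
    (h : ∀ ε : S, IsIdempotentElem ε → ∃ (G : Type u) (_ : Group G), H.mem G ∧
      ∃ ψ : Subsemigroup.corner ε →ₙ* G, Function.Injective ψ) :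
    H.MemL S := by
  refine ⟨inferInstance, fun ε hε => ?_⟩
  obtain ⟨G, _, hG, ψ, hψ⟩ := h ε hε
  have := H.finite_of_mem G hG
  let P₀ : Submonoid G :=
    { carrier := Set.range ψ
      mul_mem' := by
        rintro _ _ ⟨a, rfl⟩ ⟨b, rfl⟩
        exact ⟨a * b, map_mul ψ a b⟩
      one_mem' := by
        let o : Subsemigroup.corner ε := ⟨ε, ε, by simp_rw [hε.eq]⟩
        have ho : o * o = o := Subtype.ext hε
        exact ⟨o, by rw [← mul_eq_left (a := ψ o), ← map_mul, ho]⟩ }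
  let P : Subgroup G :=
    { P₀ with
      inv_mem' := by
        intro x hx
        have : x⁻¹ = x ^ (orderOf x - 1) := by
          rw [inv_eq_iff_mul_eq_one, ← pow_succ', Nat.sub_add_cancel (orderOf_pos x),
            pow_orderOf_eq_one]
        rw [this]
        exact P₀.pow_mem hx _ }
  refine ⟨P, inferInstance, H.mem_subgroup G P hG, ⟨MulEquiv.ofBijective
    ({ toFun := fun x => ⟨ψ x, x, rfl⟩
       map_mul' := fun x y => Subtype.ext (map_mul ψ x y) } :
      Subsemigroup.corner ε →ₙ* P) ⟨fun x y hxy => hψ (congrArg Subtype.val hxy), ?_⟩⟩⟩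
  rintro ⟨_, x, rfl⟩
  exact ⟨x, rfl⟩

/-- `LH` is closed under subdirect products of two semigroups. -/
theorem GroupPseudovariety.MemL.of_injective_pair {H : GroupPseudovariety.{u}} {S T₁ T₂ : Type u}
    [Semigroup S] [Semigroup T₁] [Semigroup T₂] (h₁ : H.MemL T₁) (h₂ : H.MemL T₂)
    (g₁ : S →ₙ* T₁) (g₂ : S →ₙ* T₂) (hg : ∀ x y, g₁ x = g₁ y → g₂ x = g₂ y → x = y) :
    H.MemL S := by
  have := h₁.1
  have := h₂.1
  have : Finite S := Finite.of_injective (fun x => (g₁ x, g₂ x)) fun x y hxy =>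
    hg x y (congrArg Prod.fst hxy) (congrArg Prod.snd hxy)
  refine H.memL_of_injective_corner fun ε hε => ?_
  obtain ⟨G₁, _, hG₁, ⟨ι₁⟩⟩ := h₁.2 (g₁ ε) (hε.map g₁)
  obtain ⟨G₂, _, hG₂, ⟨ι₂⟩⟩ := h₂.2 (g₂ ε) (hε.map g₂)
  refine ⟨G₁ × G₂, inferInstance, H.mem_prod _ _ hG₁ hG₂,
    ((ι₁ : _ →ₙ* G₁).comp (Subsemigroup.cornerMap g₁ ε)).prod
      ((ι₂ : _ →ₙ* G₂).comp (Subsemigroup.cornerMap g₂ ε)), fun x y hxy => ?_⟩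
  have e₁ := ι₁.injective (congrArg Prod.fst hxy)
  have e₂ := ι₂.injective (congrArg Prod.snd hxy)
  exact Subtype.ext (hg _ _ (congrArg Subtype.val e₁) (congrArg Subtype.val e₂))

/-- The homomorphism between preimages of idempotents induced by a commutative square. -/
def idempotentPreimageMap {M M' N N' : Type u} [Monoid M] [Monoid M'] [Monoid N] [Monoid N']
    {f : M →* N} {f' : M' →* N'} {e : N} {he : IsIdempotentElem e} {e' : N'}
    (he' : IsIdempotentElem e') (h : M →* M') (hf : ∀ m, f m = e → f' (h m) = e') :
    idempotentPreimage f e he →ₙ* idempotentPreimage f' e' he' where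
  toFun x := ⟨h x.1, hf x.1 x.2⟩
  map_mul' x y := Subtype.ext (map_mul h x.1 y.1)

theorem IsLHHom.prodMap {H : GroupPseudovariety.{u}} {M M' N N' : Type u} [Monoid M] [Monoid M']
    [Monoid N] [Monoid N'] {f : M →* N} {f' : M' →* N'} (hf : IsLHHom H f) (hf' : IsLHHom H f') :
    IsLHHom H (f.prodMap f') := by
  intro e he
  have he₁ : IsIdempotentElem e.1 := congrArg Prod.fst he
  have he₂ : IsIdempotentElem e.2 := congrArg Prod.snd he
  refine (hf e.1 he₁).of_injective_pair (hf' e.2 he₂)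
    (idempotentPreimageMap he₁ (MonoidHom.fst M M') fun m hm => congrArg Prod.fst hm)
    (idempotentPreimageMap he₂ (MonoidHom.snd M M') fun m hm => congrArg Prod.snd hm)
    fun x y h₁ h₂ => Subtype.ext (Prod.ext (congrArg Subtype.val h₁) (congrArg Subtype.val h₂))

theorem IsLHHom.restrict {H : GroupPseudovariety.{u}} {M N : Type u} [Monoid M] [Monoid N]
    {f : M →* N} (hf : IsLHHom H f) (P : Submonoid M) : IsLHHom H (f.comp P.subtype) := by
  intro e he
  -- Using the inclusion as both coordinates reduces the pair criterion to closure under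
  -- subsemigroups.
  refine (hf e he).of_injective_pair (hf e he)
    (idempotentPreimageMap he P.subtype fun _ hm => hm)
    (idempotentPreimageMap he P.subtype fun _ hm => hm)
    fun x y h _ => Subtype.ext (Subtype.ext (congrArg (fun z => z.1) h))

theorem GroupPseudovariety.isLHHom_radicalCon {H : GroupPseudovariety.{u}} (hH : H.IsFitting)
    (M : Type u) [Monoid M] [Finite M] : IsLHHom H (H.radicalCon M).mk' :=
  isLHHom_of_ker_le hH _ fun _ _ h => (Con.eq _).1 h

/-- `M / ker f` embeds in `N`, and the quotient by `c` is an image of it. -/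
theorem MonoidPseudovariety.mem_quotient_of_ker_le (V : MonoidPseudovariety.{u}) {M N : Type u}
    [Monoid M] [Monoid N] (hN : V.mem N) (f : M →* N) (c : Con M)
    (hc : ∀ s t, f s = f t → c s t) : V.mem c.Quotient := by
  have hker : V.mem (Con.ker f).Quotient :=
    V.mem_of_surjective _ _ (Con.quotientKerEquivRange f).symm.toMonoidHom
      (Con.quotientKerEquivRange f).symm.surjective (V.mem_submonoid N _ hN)
  refine V.mem_of_surjective _ _ (Con.map (Con.ker f) c fun s t h => hc s t h) ?_ hker
  intro x
  obtain ⟨m, rfl⟩ := Con.mk'_surjective x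
  exact ⟨(m : (Con.ker f).Quotient), rfl⟩

/-- The monoids whose quotient by the radical congruence belongs to `V`. -/
def MonoidPseudovariety.radicalPullback (V : MonoidPseudovariety.{u})
    (H : GroupPseudovariety.{u}) (hH : H.IsFitting) : MonoidPseudovariety.{u} where
  mem M _ := Finite M ∧ V.mem (H.radicalCon M).Quotient
  finite_of_mem _ _ h := h.1
  mem_punit := ⟨inferInstance, V.mem_quotient_of_ker_le V.mem_punit (MonoidHom.id PUnit) _
    fun s t _ => Subsingleton.elim s t ▸ Con.refl _ s⟩
  mem_prod M N _ _ hM hN := by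
    have := hM.1
    have := hN.1
    exact ⟨inferInstance, V.mem_quotient_of_ker_le (V.mem_prod _ _ hM.2 hN.2)
      ((H.radicalCon M).mk'.prodMap (H.radicalCon N).mk') _ fun _ _ h =>
        ((H.isLHHom_radicalCon hH M).prodMap (H.isLHHom_radicalCon hH N)).ker_le h⟩
  mem_submonoid M _ P hM := by
    have := hM.1
    exact ⟨inferInstance, V.mem_quotient_of_ker_le hM.2 ((H.radicalCon M).mk'.comp P.subtype) _
      fun _ _ h => ((H.isLHHom_radicalCon hH M).restrict P).ker_le h⟩
  mem_of_surjective M N _ _ f hf hM := by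
    have := hM.1
    refine ⟨Finite.of_surjective f hf, V.mem_of_surjective _ _
      ((H.radicalCon M).lift ((H.radicalCon N).mk'.comp f) fun s t h =>
        (Con.eq _).2 (H.radicalCon_map hH f hf h)) ?_ hM.2⟩
    exact Con.lift_surjective_of_surjective _ (Con.mk'_surjective.comp hf)

/-- `radicalPullback` contains the generators, by `IsLHHom.ker_le`. -/
theorem mem_quotient_radicalCon_of_mem_malcevProduct {V : MonoidPseudovariety.{u}}
    {H : GroupPseudovariety.{u}} (hH : H.IsFitting) {M : Type u} [Monoid M]
    (hM : (malcevProduct (fun S _ => H.MemL S) V).mem M) :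
    V.mem (H.radicalCon M).Quotient := by
  refine (hM (V.radicalPullback H hH) ?_).2
  rintro M _ hfin ⟨N, _, f, hN, hf⟩
  exact ⟨hfin, V.mem_quotient_of_ker_le hN f _ fun s t h => IsLHHom.ker_le hf h⟩

/-! ### Transport between the local monoids of a category. -/

section Category

variable {C : Type w} [Category.{u} C]

/-- An element of a local monoid, regarded as an arrow. -/
def LocalMonoid.hom {c : C} (f : LocalMonoid c) : c ⟶ c := f

/-- A loop, regarded as an element of a local monoid. -/
def LocalMonoid.of {c : C} (f : c ⟶ c) : LocalMonoid c := f

@[simp] theorem LocalMonoid.hom_of {c : C} (f : c ⟶ c) : (LocalMonoid.of f).hom = f := rfl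

@[simp] theorem LocalMonoid.hom_mul {c : C} (f g : LocalMonoid c) :
    (f * g).hom = f.hom ≫ g.hom := rfl

theorem LocalMonoid.hom_injective {c : C} : Function.Injective (LocalMonoid.hom (c := c)) :=
  Function.injective_id

open LocalMonoid

/-- The homomorphism between local monoids at conjugate idempotents given by `z ↦ α ≫ z ≫ β`. -/
def IsIdempotentElem.Corner.conj {c d : C} {e : LocalMonoid d} {e' : LocalMonoid c}
    (he : IsIdempotentElem e) (he' : IsIdempotentElem e') (α : d ⟶ c) (β : c ⟶ d)
    (hαβ : α ≫ β = e.hom) (hβα : β ≫ α = e'.hom) (hα : e.hom ≫ α = α)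
    (hβ : e'.hom ≫ β = β) : he'.Corner →* he.Corner where
  toFun z := ⟨of (α ≫ hom z.1 ≫ β), by
    have hβ' : β ≫ e.hom = β := by rw [← hαβ, ← Category.assoc, hβα, hβ]
    refine (Subsemigroup.mem_corner_iff he).2 ⟨hom_injective ?_, hom_injective ?_⟩
    · simp only [hom_mul, hom_of, ← Category.assoc, hα]
    · simp only [hom_mul, hom_of, Category.assoc, hβ']⟩
  map_one' := Subtype.ext <| hom_injective <| by
    change α ≫ e'.hom ≫ β = e.hom
    rw [hβ, hαβ]
  map_mul' z w := Subtype.ext <| hom_injective <| by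
    have h : hom z.1 ≫ e'.hom = hom z.1 := congrArg hom (mul_right he' z)
    change α ≫ (hom z.1 ≫ hom w.1) ≫ β = (α ≫ hom z.1 ≫ β) ≫ (α ≫ hom w.1 ≫ β)
    generalize hom z.1 = z₀ at h ⊢
    nth_rw 1 [← h]
    simp only [← hβα, Category.assoc]

theorem IsIdempotentElem.Corner.conj_conj {c d : C} {e : LocalMonoid d} {e' : LocalMonoid c}
    (he : IsIdempotentElem e) (he' : IsIdempotentElem e') (α : d ⟶ c) (β : c ⟶ d)
    (hαβ : α ≫ β = e.hom) (hβα : β ≫ α = e'.hom) (hα : e.hom ≫ α = α)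
    (hβ : e'.hom ≫ β = β) (z : he.Corner) :
    conj he he' α β hαβ hβα hα hβ (conj he' he β α hβα hαβ hβ hα z) = z := by
  have hl : e.hom ≫ hom z.1 = hom z.1 := congrArg hom (left_mul he z)
  have hr : hom z.1 ≫ e.hom = hom z.1 := congrArg hom (mul_right he z)
  refine Subtype.ext (hom_injective ?_)
  change α ≫ (β ≫ hom z.1 ≫ α) ≫ β = hom z.1
  generalize hom z.1 = z₀ at hl hr ⊢
  rw [← hαβ] at hl hr
  simp only [Category.assoc] at hl ⊢
  rw [hr, hl]

theorem IsIdempotentElem.Corner.conj_compress {c d : C} {e : LocalMonoid d} {e' : LocalMonoid c}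
    (he : IsIdempotentElem e) (he' : IsIdempotentElem e') (α : d ⟶ c) (β : c ⟶ d)
    (hαβ : α ≫ β = e.hom) (hβα : β ≫ α = e'.hom) (hα : e.hom ≫ α = α)
    (hβ : e'.hom ≫ β = β) (p : d ⟶ c) (g : LocalMonoid c) (q : c ⟶ d) :
    conj he he' α β hαβ hβα hα hβ (compress he' (of (β ≫ p) * g * of (q ≫ α))) =
      compress he (of (p ≫ g.hom ≫ q)) := by
  have hα' : α ≫ e'.hom = α := by rw [← hβα, ← Category.assoc, hαβ, hα]
  refine Subtype.ext (hom_injective ?_)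
  change α ≫ ((e'.hom ≫ (((β ≫ p) ≫ g.hom) ≫ (q ≫ α))) ≫ e'.hom) ≫ β =
    (e.hom ≫ (p ≫ g.hom ≫ q)) ≫ e.hom
  rw [Category.assoc, Category.assoc, hβ, ← Category.assoc α, hα', ← hαβ]
  simp only [Category.assoc]

/-- Two non-units are always related, so one element may be assumed a unit. -/
theorem GroupPseudovariety.UnitRel.of_isUnit_imp {H : GroupPseudovariety.{u}} {A : Type u}
    [Monoid A] {a b : A} (h : IsUnit a → H.UnitRel a b) (h' : IsUnit b → H.UnitRel b a) :
    H.UnitRel a b :=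
  ⟨⟨fun ha => (h ha).1.1 ha, fun hb => (h' hb).1.1 hb⟩,
    fun u v hu hv => (h (hu ▸ u.isUnit)).2 u v hu hv⟩

/-- With `k` inverse to the unit, `α = e p f` and `β = q k` satisfy `αβ = e`. Hence `βα` is an
idempotent at `c` with local monoid isomorphic to that at `e`, and the hypothesis at `βα`, with
translation by `βp` and `qα`, gives the claim. -/
theorem unitRel_compress_of_radicalCon {H : GroupPseudovariety.{u}} (hH : H.IsFitting)
    {c d : C} [Finite (LocalMonoid c)] {f g : LocalMonoid c}
    (h : H.radicalCon (LocalMonoid c) f g) (p : d ⟶ c) (q : c ⟶ d) {e : LocalMonoid d}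
    (he : IsIdempotentElem e) (hu : IsUnit (compress he (of (p ≫ f.hom ≫ q)))) :
    H.UnitRel (compress he (of (p ≫ f.hom ≫ q))) (compress he (of (p ≫ g.hom ≫ q))) := by
  obtain ⟨u, hu⟩ := hu
  let k : d ⟶ d := hom (u⁻¹).val.1
  have hee : e.hom ≫ e.hom = e.hom := he
  have hk : e.hom ≫ k = k := left_mul he (u⁻¹).val
  have hk' : k ≫ e.hom = k := mul_right he (u⁻¹).val
  have hinv : ((e.hom ≫ (p ≫ f.hom ≫ q)) ≫ e.hom) ≫ k = e.hom := by
    have := congrArg Subtype.val u.mul_inv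
    rw [hu] at this
    exact this
  let α : d ⟶ c := e.hom ≫ p ≫ f.hom
  let β : c ⟶ d := q ≫ k
  have hαβ : α ≫ β = e.hom := by
    rw [Category.assoc, hk] at hinv
    simpa [α, β] using hinv
  have hα : e.hom ≫ α = α := by simp only [α, ← Category.assoc, hee]
  have hβ : β ≫ e.hom = β := by simp only [β, Category.assoc, hk']
  have hβ' : (β ≫ α) ≫ β = β := by rw [Category.assoc, hαβ, hβ]
  have he' : IsIdempotentElem (of (β ≫ α)) := hom_injective <| by
    simp only [hom_mul, hom_of]
    rw [← Category.assoc, hβ']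
  have hΦ := conj_conj he he' α β hαβ rfl hα hβ'
  have hΨ := conj_conj he' he β α rfl hαβ hβ' hα
  have := (h _ he' (of (β ≫ p)) (of (q ≫ α))).map hH (conj he he' α β hαβ rfl hα hβ')
    (fun z => ⟨_, hΦ z⟩) (fun a ha => hΨ a ▸ ha.map (conj he' he β α rfl hαβ hβ' hα))
  have hc (k : LocalMonoid c) := conj_compress he he' α β hαβ rfl hα hβ' p k q
  exact hc f ▸ hc g ▸ this

/-- The radical congruence of the local monoids is stable under translations from one object
to another. -/
theorem radicalCon_translate {H : GroupPseudovariety.{u}} (hH : H.IsFitting)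
    (hC : IsFiniteCategory C) {c d : C} {f g : LocalMonoid c}
    (h : H.radicalCon (LocalMonoid c) f g) (p : d ⟶ c) (q : c ⟶ d) :
    H.radicalCon (LocalMonoid d) (of (p ≫ f.hom ≫ q)) (of (p ≫ g.hom ≫ q)) := by
  have : Finite (LocalMonoid c) := hC.2 c c
  intro e he x y
  have key (k : c ⟶ c) : x * of (p ≫ k ≫ q) * y = of ((x.hom ≫ p) ≫ k ≫ (q ≫ y.hom)) :=
    hom_injective (by simp)
  rw [key, key]
  exact .of_isUnit_imp (unitRel_compress_of_radicalCon hH h _ _ he)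
    (unitRel_compress_of_radicalCon hH (Con.symm _ h) _ _ he)

/-- The relation on the arrows of a category identifying two parallel arrows when all their
translates to loops are identified by the radical congruence. -/
def GroupPseudovariety.radicalHomRel (H : GroupPseudovariety.{u}) (C : Type w)
    [Category.{u} C] : HomRel C :=
  fun a b f g => ∀ (c : C) (p : c ⟶ a) (q : b ⟶ c),
    H.radicalCon (LocalMonoid c) (p ≫ f ≫ q) (p ≫ g ≫ q)

instance (H : GroupPseudovariety.{u}) : Congruence (H.radicalHomRel C) where
  equivalence :=
    { refl := fun _ _ _ _ => Con.refl _ _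
      symm := fun h c p q => Con.symm _ (h c p q)
      trans := fun h h' c p q => Con.trans _ (h c p q) (h' c p q) }
  comp_left k _ _ h c p q := by simpa using h c (p ≫ k) q
  comp_right k h c p q := by simpa using h c p (k ≫ q)

/-- Translation stability ensures that loops acquire no identifications or separations beyond those
of `radicalCon`. -/
theorem radicalHomRel_iff {H : GroupPseudovariety.{u}} (hH : H.IsFitting)
    (hC : IsFiniteCategory C) {c : C} {f g : c ⟶ c} :
    H.radicalHomRel C f g ↔ H.radicalCon (LocalMonoid c) f g := by
  refine ⟨fun h => ?_, fun h d p q => radicalCon_translate hH hC h p q⟩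
  simpa using h c (𝟙 c) (𝟙 c)

end Category

theorem theorem2 (V : MonoidPseudovariety.{u}) (H : GroupPseudovariety.{u}) (hH : H.IsFitting)
    (C : Type w) [Category.{u} C] (hC : IsFiniteCategory C) :
    (malcevProduct (fun S _ => H.MemL S) V).MemLocal C ↔
      ∃ (D : Type w) (_ : Category.{u} D) (φ : C ⥤ D), IsLHMorphism H φ ∧ V.MemLocal D := by
  have hfin (c : C) : Finite (LocalMonoid c) := hC.2 c c
  constructor
  · intro h
    let φ := Quotient.functor (H.radicalHomRel C)
    have hobj : Function.Bijective φ.obj :=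
      (Quotient.equiv (H.radicalHomRel C)).symm.bijective
    have hmap (c c' : C) : Function.Surjective (φ.map : (c ⟶ c') → (φ.obj c ⟶ φ.obj c')) :=
      φ.map_surjective
    have hker (c : C) (s t : LocalMonoid c) :
        localHom φ c s = localHom φ c t ↔ H.radicalCon (LocalMonoid c) s t :=
      (Quotient.functor_map_eq_iff _ _ _).trans (radicalHomRel_iff hH hC)
    have := hC.1
    refine ⟨CategoryTheory.Quotient (H.radicalHomRel C), inferInstance, φ, ⟨⟨hobj, hmap⟩,
      fun c => isLHHom_of_ker_le hH (localHom φ c) fun s t => (hker c s t).1⟩,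
      ⟨Finite.of_surjective _ hobj.2, ?_⟩, ?_⟩
    · intro d d'
      obtain ⟨c, rfl⟩ := hobj.2 d
      obtain ⟨c', rfl⟩ := hobj.2 d'
      have := hC.2 c c'
      exact Finite.of_surjective _ (hmap c c')
    · intro d
      obtain ⟨c, rfl⟩ := hobj.2 d
      -- The local monoid of the quotient category is an image of `C_c / radicalCon`, which lies in
      -- `V`.
      refine V.mem_of_surjective _ _ (Con.lift _ (localHom φ c) fun s t => (hker c s t).2) ?_
        (mem_quotient_radicalCon_of_mem_malcevProduct hH (h.2 c))
      exact Con.lift_surjective_of_surjective _ (hmap c c)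
  · rintro ⟨D, _, φ, hφ, hD⟩
    exact ⟨hC, fun c W hW => hW _ ⟨_, _, localHom φ c, hD.2 _, hφ.2 c⟩⟩
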